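/- Let $X$ and $Y$ be completely regular Hausdorff spaces. For a topological space $Z$, a zero-set is a set $f^{-1}(0)$ with $f:Z\to\mathbb R$ continuous; $\mathcal U(Z)$ denotes the algebra and $\mathcal B_a(Z)$ the $\sigma$-algebra generated by the zero-sets, and $C_b(Z)$ the space of bounded continuous real functions. A Baire probability measure $\mu$ on $X$ (a countably additive probability measure on $\mathcal B_a(X)$) is called separable if for every bounded continuous pseudometric $d$ on $X$ it is concentrated on a subset of $X$ that has a countable $d$-dense subset. Let $\mathcal M^1(Z)$ be the set of non-negative finitely additive set functions $\gamma$ on $\mathcal U(Z)$ with $\gamma(Z)=1$ that are regular: for all $A\in\mathcal U(Z)$ and $\varepsilon>0$ there is a zero-set $F\subseteq A$ such that $\gamma(B)<\varepsilon$ for all $B\in\mathcal U(Z)$ with $B\subseteq A\setminus F$. Let $c:X\times Y\to\mathbb R$ be a bounded function with property (H): for all $x_0\in X$ and $y_0\in Y$, $$\lim_{x\to x_0}\sup_{y\in Y}|c(x,y)-c(x_0,y)|=0,\qquad \lim_{y\to y_0}\sup_{x\in X}|c(x,y)-c(x,y_0)|=0 .$$ Let $\mu$ and $\nu$ be separable Baire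 probability measures on $X$ and $Y$. Put $$\Gamma(\mu,\nu)=\Big\{\gamma\in\mathcal M^1(X\times Y):\ \int_{X\times Y}(\phi(x)+\psi(y))\,d\gamma=\int_X\phi\,d\mu+\int_Y\psi\,d\nu\ \ \forall\phi\in C_b(X),\ \forall\psi\in C_b(Y)\Big\},$$ $$v_{\min}(\mathrm{OP})=\inf\Big\{\int_{X\times Y} c\,d\gamma:\ \gamma\in\Gamma(\mu,\nu)\Big\},$$ $$v_{\max}(\mathrm{DP})=\sup\Big\{\int_X\phi\,d\mu+\int_Y\psi\,d\nu:\ \phi\in C_b(X),\ \psi\in C_b(Y),\ \phi(x)+\psi(y)\le c(x,y)\ \ \forall (x,y)\in X\times Y\Big\}.$$ For bounded $\xi:X\to\mathbb R$ and $\zeta:Y\to\mathbb R$ let $\xi^{c}(y)=\inf_{x\in X}(c(x,y)-\xi(x))$ and $\zeta^{\bar c}(x)=\inf_{y\in Y}(c(x,y)-\zeta(y))$, and write $\xi^{c\bar c}=(\xi^{c})^{\bar c}$. Then the infimum $v_{\min}(\mathrm{OP})$ is attained at some $\gamma^*\in\Gamma(\mu,\nu)$, and there is $\xi_0\in C_b(X)$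 such that $(\phi^*,\psi^*)=(\xi_0^{c\bar c},\xi_0^{c})$ belongs to $C_b(X)\times C_b(Y)$, satisfies $\phi^*(x)+\psi^*(y)\le c(x,y)$ for all $(x,y)$, and attains the supremum $v_{\max}(\mathrm{DP})$. Moreover $$\int_X\phi^*\,d\mu+\int_Y\psi^*\,d\nu=v_{\max}(\mathrm{DP})=v_{\min}(\mathrm{OP})=\int_{X\times Y}c\,d\gamma^* .$$ -/

import Mathlib

open MeasureTheory Topology Filter
open scoped BoundedContinuousFunction

noncomputable section

namespace BaireTransport

/-- The zero-sets of a topological space: the sets `f ⁻¹(0)` with `f` real-valued continuous. -/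
def zeroSets (Z : Type*) [TopologicalSpace Z] : Set (Set Z) :=
  {F | ∃ f : C(Z, ℝ), F = f ⁻¹' {0}}

/-- The algebra of sets generated by the zero-sets. -/
def zeroSetAlgebra (Z : Type*) [TopologicalSpace Z] : Set (Set Z) :=
  generateSetAlgebra (zeroSets Z)

/-- The measurable space structure on `X` is the Baire σ-algebra, that is, the σ-algebra generated
by the zero-sets (compare Mathlib's `BorelSpace`). A measure on `X` is then a Baire measure. -/
class BaireSigmaAlgebra (X : Type*) [TopologicalSpace X] [mX : MeasurableSpace X] : Prop where
  measurable_eq : mX = MeasurableSpace.generateFrom (zeroSets X)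

/-- Bounded continuous pseudometrics on a topological space. -/
structure IsBoundedContinuousPseudometric {X : Type*} [TopologicalSpace X] (d : X → X → ℝ) :
    Prop where
  nonneg : ∀ x y, 0 ≤ d x y
  self : ∀ x, d x x = 0
  symm : ∀ x y, d x y = d y x
  triangle : ∀ x y z, d x z ≤ d x y + d y z
  continuous : Continuous fun p : X × X => d p.1 p.2
  bounded : ∃ M : ℝ, ∀ x y, d x y ≤ M

/-- A (Baire) measure is separable if, for every bounded continuous pseudometric `d`, it is
concentrated on a subset that has a countable `d`-dense subset. -/
def IsSeparableMeasure {X : Type*} [TopologicalSpace X] [MeasurableSpace X] (μ : Measure X) :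
    Prop :=
  ∀ d : X → X → ℝ, IsBoundedContinuousPseudometric d →
    ∃ S : Set X, μ Sᶜ = 0 ∧
      ∃ D : Set X, D ⊆ S ∧ D.Countable ∧ ∀ x ∈ S, ∀ ε > 0, ∃ a ∈ D, d x a < ε

/-- Non-negative, finitely additive, zero-set regular set functions of total mass `1` on the algebra
generated by the zero-sets. (An `AddContent` is a function on all sets, but only its values on the
algebra are constrained, and only these are used.) -/
structure ProbabilityCharge (Z : Type*) [TopologicalSpace Z] where
  /-- the underlying finitely additive set function -/
  content : AddContent ℝ (zeroSetAlgebra Z)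
  nonneg : ∀ A ∈ zeroSetAlgebra Z, 0 ≤ content A
  regular : ∀ A ∈ zeroSetAlgebra Z, ∀ ε > 0, ∃ F ∈ zeroSets Z, F ⊆ A ∧
    ∀ B ∈ zeroSetAlgebra Z, B ⊆ A \ F → |content B| < ε
  mass : content Set.univ = 1

/-- The integrals of the simple functions below `f`: the sums `∑ aᵢ γ(Aᵢ)` over the finite
partitions of `Z` into sets `Aᵢ` of the algebra, where `aᵢ ≤ f` on `Aᵢ`. -/
def ProbabilityCharge.lowerSums {Z : Type*} [TopologicalSpace Z] (γ : ProbabilityCharge Z)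
    (f : Z → ℝ) : Set ℝ :=
  {r | ∃ (n : ℕ) (A : Fin n → Set Z) (a : Fin n → ℝ),
    (∀ i, A i ∈ zeroSetAlgebra Z) ∧ Pairwise (Function.onFun Disjoint A) ∧
    (⋃ i, A i) = Set.univ ∧ (∀ i, ∀ z ∈ A i, a i ≤ f z) ∧
    r = ∑ i, a i * γ.content (A i)}

/-- The integral of a bounded function against a charge, as the supremum of the integrals of the
simple functions below it. A bounded continuous `f` is a uniform limit of simple functions over the
algebra, so for such `f` this is also the infimum of the integrals of the simple functions above
`f`, and the limit of the integrals of any simple functions that converge uniformly to `f`. -/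
def ProbabilityCharge.integral {Z : Type*} [TopologicalSpace Z] (γ : ProbabilityCharge Z)
    (f : Z → ℝ) : ℝ :=
  sSup (γ.lowerSums f)

variable {X Y : Type*}

/-- The set `Γ(μ, ν)`. -/
def plans [TopologicalSpace X] [TopologicalSpace Y] [MeasurableSpace X] [MeasurableSpace Y]
    (μ : Measure X) (ν : Measure Y) : Set (ProbabilityCharge (X × Y)) :=
  {γ | ∀ (φ : X →ᵇ ℝ) (ψ : Y →ᵇ ℝ),
    γ.integral (fun p => φ p.1 + ψ p.2) = ∫ x, φ x ∂μ + ∫ y, ψ y ∂ν}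

/-- The value of the problem (OP). -/
def valueOP [TopologicalSpace X] [TopologicalSpace Y] [MeasurableSpace X] [MeasurableSpace Y]
    (c : X × Y → ℝ) (μ : Measure X) (ν : Measure Y) : ℝ :=
  sInf ((fun γ : ProbabilityCharge (X × Y) => γ.integral c) '' plans μ ν)

/-- The admissible pairs of the dual problem (DP). -/
def dualAdmissible [TopologicalSpace X] [TopologicalSpace Y] (c : X × Y → ℝ) :
    Set ((X →ᵇ ℝ) × (Y →ᵇ ℝ)) :=
  {q | ∀ x y, q.1 x + q.2 y ≤ c (x, y)}

/-- The objective of the dual problem (DP). -/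
def dualObjective [TopologicalSpace X] [TopologicalSpace Y] [MeasurableSpace X] [MeasurableSpace Y]
    (μ : Measure X) (ν : Measure Y) (q : (X →ᵇ ℝ) × (Y →ᵇ ℝ)) : ℝ :=
  ∫ x, q.1 x ∂μ + ∫ y, q.2 y ∂ν

/-- The value of the dual problem (DP). -/
def valueDP [TopologicalSpace X] [TopologicalSpace Y] [MeasurableSpace X] [MeasurableSpace Y]
    (c : X × Y → ℝ) (μ : Measure X) (ν : Measure Y) : ℝ :=
  sSup (dualObjective μ ν '' dualAdmissible c)

/-- The `c`-transform `ξ^c` of a function on `X`. -/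
def cTransform (c : X × Y → ℝ) (ξ : X → ℝ) : Y → ℝ :=
  fun y => ⨅ x, (c (x, y) - ξ x)

/-- The transform of a function on `Y` with the variables of `c` exchanged. -/
def cBarTransform (c : X × Y → ℝ) (ζ : Y → ℝ) : X → ℝ :=
  fun x => ⨅ y, (c (x, y) - ζ y)

/-- Property (H). -/
def PropertyH [TopologicalSpace X] [TopologicalSpace Y] (c : X × Y → ℝ) : Prop :=
  (∀ x₀ : X, Tendsto (fun x => ⨆ y, |c (x, y) - c (x₀, y)|) (𝓝 x₀) (𝓝 0)) ∧
  (∀ y₀ : Y, Tendsto (fun y => ⨆ x, |c (x, y) - c (x, y₀)|) (𝓝 y₀) (𝓝 0))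

end BaireTransport

end

open BaireTransport

open MeasureTheory Topology Filter
open scoped BoundedContinuousFunction

noncomputable section

namespace BaireTransport

/-! ### Zero-sets as a lattice, and separation of disjoint ones -/

section ZeroSets

variable {Z : Type*} [TopologicalSpace Z]

/-! The dual side is compactness. Replacing a pair by transforms does not lower its value, and by
(H) transforms are 1-Lipschitz for the continuous pseudometrics `sup_y |c(x,y) - c(x',y)|` and
`sup_x |c(x,y) - c(x,y')|`, whatever function is transformed. After a constant is moved from one
potential to the other they are also uniformly bounded (`exists_improved_admissible`). Separability
of the measures then yields an a.e. convergent maximizing sequence; its limit along an ultrafilter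
exists everywhere, stays Lipschitz and admissible, and attains the supremum by dominated
convergence.

The primal side is Hahn–Banach in M. Riesz's form. With `V` the dual value, optimality says that a
constant in `dualCone` is nonnegative. Extending from the constants gives a positive normalized
functional `L` on the bounded continuous functions of the product, with the right marginals and `L c
≤ V` (`exists_state_of_dual_le`). Alexandrov's representation theorem, proved here through inner
masses of zero-sets, turns `L` into a regular charge (`IsState.charge`, `IsState.integral_charge`).
Weak duality closes the gap. -/

theorem setOf_le_mem_zeroSets {f : Z → ℝ} (hf : Continuous f) (a : ℝ) :
    {z | f z ≤ a} ∈ zeroSets Z :=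
  ⟨⟨fun z => max (f z - a) 0, by fun_prop⟩, by ext z; simp⟩

theorem setOf_ge_mem_zeroSets {f : Z → ℝ} (hf : Continuous f) (a : ℝ) :
    {z | a ≤ f z} ∈ zeroSets Z := by
  simpa using setOf_le_mem_zeroSets hf.neg (-a)

theorem empty_mem_zeroSets : (∅ : Set Z) ∈ zeroSets Z :=
  ⟨1, by ext z; simp⟩

theorem univ_mem_zeroSets : (Set.univ : Set Z) ∈ zeroSets Z :=
  ⟨0, by ext z; simp⟩

theorem union_mem_zeroSets {F G : Set Z} (hF : F ∈ zeroSets Z) (hG : G ∈ zeroSets Z) :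
    F ∪ G ∈ zeroSets Z := by
  obtain ⟨f, rfl⟩ := hF
  obtain ⟨g, rfl⟩ := hG
  exact ⟨f * g, by ext z; simp⟩

theorem inter_mem_zeroSets {F G : Set Z} (hF : F ∈ zeroSets Z) (hG : G ∈ zeroSets Z) :
    F ∩ G ∈ zeroSets Z := by
  obtain ⟨f, rfl⟩ := hF
  obtain ⟨g, rfl⟩ := hG
  refine ⟨⟨fun z => |f z| + |g z|, by fun_prop⟩, ?_⟩
  ext z
  simp [add_eq_zero_iff_of_nonneg (abs_nonneg (f z)) (abs_nonneg (g z))]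

theorem isSetAlgebra_zeroSetAlgebra : IsSetAlgebra (zeroSetAlgebra Z) :=
  isSetAlgebra_generateSetAlgebra

theorem zeroSets_subset_zeroSetAlgebra : zeroSets Z ⊆ zeroSetAlgebra Z :=
  self_subset_generateSetAlgebra

/-- Disjoint zero-sets are separated by a continuous function with values in `[0, 1]`. -/
theorem exists_separating_of_disjoint_zeroSets {F G : Set Z} (hF : F ∈ zeroSets Z)
    (hG : G ∈ zeroSets Z) (h : Disjoint F G) :
    ∃ s : Z →ᵇ ℝ, (∀ z, 0 ≤ s z) ∧ (∀ z, s z ≤ 1) ∧ (∀ z ∈ F, s z = 0) ∧ ∀ z ∈ G, s z = 1 := by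
  obtain ⟨f, rfl⟩ := hF
  obtain ⟨g, rfl⟩ := hG
  have hpos : ∀ z, 0 < |f z| + |g z| := by
    intro z
    have : ¬(f z = 0 ∧ g z = 0) := fun hz => Set.disjoint_left.mp h hz.1 hz.2
    rcases not_and_or.mp this with h | h
    · have := abs_pos.mpr h; positivity
    · have := abs_pos.mpr h; positivity
  have h0 : ∀ z, 0 ≤ |f z| / (|f z| + |g z|) := fun z => by positivity
  have h1 : ∀ z, |f z| / (|f z| + |g z|) ≤ 1 := fun z =>
    (div_le_one (hpos z)).mpr (by linarith [abs_nonneg (g z)])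
  refine ⟨BoundedContinuousFunction.ofNormedAddCommGroup
    (fun z => |f z| / (|f z| + |g z|)) ?_ 1 ?_, h0, h1, ?_, ?_⟩
  · exact Continuous.div (by fun_prop) (by fun_prop) fun z => (hpos z).ne'
  · intro z
    rw [Real.norm_eq_abs, abs_of_nonneg (h0 z)]
    exact h1 z
  · intro z hz
    have : f z = 0 := hz
    simp [this]
  · intro z hz
    have hg : g z = 0 := hz
    have := hpos z
    simp only [hg, abs_zero, add_zero] at this
    simp [hg, this.ne']

end ZeroSets

/-! ### Alexandrov representation: from a positive functional to a regular charge -/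

section Representation

variable {Z : Type*} [TopologicalSpace Z]

/-- The values of `L` on the non-negative functions that are at least `1` on `F`. -/
def majorantValues (L : (Z →ᵇ ℝ) →ₗ[ℝ] ℝ) (F : Set Z) : Set ℝ :=
  {r | ∃ f : Z →ᵇ ℝ, (∀ z, 0 ≤ f z) ∧ (∀ z ∈ F, 1 ≤ f z) ∧ L f = r}

/-- The mass that a positive functional gives to a zero-set. -/
def zeroSetMass (L : (Z →ᵇ ℝ) →ₗ[ℝ] ℝ) (F : Set Z) : ℝ :=
  sInf (majorantValues L F)

/-- The inner mass of a set: the supremum of the masses of the zero-sets it contains. -/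
def innerMass (L : (Z →ᵇ ℝ) →ₗ[ℝ] ℝ) (A : Set Z) : ℝ :=
  sSup (zeroSetMass L '' {F | F ∈ zeroSets Z ∧ F ⊆ A})

/-- Positive normalized linear functionals on the bounded continuous functions. -/
structure IsState (L : (Z →ᵇ ℝ) →ₗ[ℝ] ℝ) : Prop where
  nonneg : ∀ f : Z →ᵇ ℝ, (∀ z, 0 ≤ f z) → 0 ≤ L f
  one : L 1 = 1

namespace IsState

variable {L : (Z →ᵇ ℝ) →ₗ[ℝ] ℝ}

theorem mono (hL : IsState L) {f g : Z →ᵇ ℝ} (h : ∀ z, f z ≤ g z) : L f ≤ L g := by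
  have := hL.nonneg (g - f) fun z => by simpa using h z
  rw [map_sub] at this
  linarith

theorem const (hL : IsState L) (a : ℝ) : L (a • 1) = a := by
  simp [hL.one]

theorem majorantValues_nonempty (hL : IsState L) (F : Set Z) : (majorantValues L F).Nonempty :=
  ⟨1, 1, fun z => by simp, fun z _ => by simp, hL.one⟩

theorem bddBelow_majorantValues (hL : IsState L) (F : Set Z) : BddBelow (majorantValues L F) :=
  ⟨0, by rintro _ ⟨f, hf, -, rfl⟩; exact hL.nonneg f hf⟩

theorem zeroSetMass_le (hL : IsState L) {F : Set Z} {f : Z →ᵇ ℝ} (h0 : ∀ z, 0 ≤ f z)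
    (h1 : ∀ z ∈ F, 1 ≤ f z) : zeroSetMass L F ≤ L f :=
  csInf_le (hL.bddBelow_majorantValues F) ⟨f, h0, h1, rfl⟩

theorem le_zeroSetMass (hL : IsState L) {F : Set Z} {r : ℝ}
    (h : ∀ f : Z →ᵇ ℝ, (∀ z, 0 ≤ f z) → (∀ z ∈ F, 1 ≤ f z) → r ≤ L f) : r ≤ zeroSetMass L F :=
  le_csInf (hL.majorantValues_nonempty F) (by rintro _ ⟨f, h0, h1, rfl⟩; exact h f h0 h1)

theorem exists_lt_zeroSetMass_add (hL : IsState L) (F : Set Z) {ε : ℝ} (hε : 0 < ε) :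
    ∃ f : Z →ᵇ ℝ, (∀ z, 0 ≤ f z) ∧ (∀ z ∈ F, 1 ≤ f z) ∧ L f < zeroSetMass L F + ε := by
  obtain ⟨_, ⟨f, h0, h1, rfl⟩, h⟩ := exists_lt_of_csInf_lt (hL.majorantValues_nonempty F)
    (show sInf (majorantValues L F) < zeroSetMass L F + ε from lt_add_of_pos_right _ hε)
  exact ⟨f, h0, h1, h⟩

theorem zeroSetMass_nonneg (hL : IsState L) (F : Set Z) : 0 ≤ zeroSetMass L F :=
  hL.le_zeroSetMass fun f h0 _ => hL.nonneg f h0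

theorem zeroSetMass_le_one (hL : IsState L) (F : Set Z) : zeroSetMass L F ≤ 1 :=
  (hL.zeroSetMass_le (f := 1) (fun z => by simp) fun z _ => by simp).trans_eq hL.one

theorem zeroSetMass_empty (hL : IsState L) : zeroSetMass L ∅ = 0 :=
  le_antisymm ((hL.zeroSetMass_le (f := 0) (fun z => by simp) fun z hz => hz.elim).trans_eq
    (map_zero L)) (hL.zeroSetMass_nonneg _)

theorem zeroSetMass_univ (hL : IsState L) : zeroSetMass L Set.univ = 1 :=
  le_antisymm (hL.zeroSetMass_le_one _) <| hL.le_zeroSetMass fun f _ h1 => by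
    rw [← hL.one]
    exact hL.mono fun z => by simpa using h1 z trivial

theorem zeroSetMass_mono (hL : IsState L) {F G : Set Z} (h : F ⊆ G) :
    zeroSetMass L F ≤ zeroSetMass L G :=
  hL.le_zeroSetMass fun _ h0 h1 => hL.zeroSetMass_le h0 fun z hz => h1 z (h hz)

theorem zeroSetMass_union_le (hL : IsState L) (F G : Set Z) :
    zeroSetMass L (F ∪ G) ≤ zeroSetMass L F + zeroSetMass L G := by
  refine le_of_forall_pos_le_add fun ε hε => ?_
  obtain ⟨f, f0, f1, hf⟩ := hL.exists_lt_zeroSetMass_add F (half_pos hε)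
  obtain ⟨g, g0, g1, hg⟩ := hL.exists_lt_zeroSetMass_add G (half_pos hε)
  have := hL.zeroSetMass_le (F := F ∪ G) (f := f + g)
    (fun z => add_nonneg (f0 z) (g0 z)) (by
      rintro z (hz | hz)
      · exact (f1 z hz).trans (le_add_of_nonneg_right (g0 z))
      · exact (g1 z hz).trans (le_add_of_nonneg_left (f0 z)))
  rw [map_add] at this
  linarith

/-- Take `f ≥ 1` on the union and `g > 1` on the intersection. The parts of `F` and `G` where `g ≤
1` are disjoint zero-sets, and a function `s` separating them splits `f + g` into two nonnegative
summands, one at least `1` on `F`, the other on `G`: each is `f ⊓ g` plus a share `1 - s` or `s` of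
`f ⊔ g - f ⊓ g`. -/
theorem zeroSetMass_supermodular (hL : IsState L) {F G : Set Z} (hF : F ∈ zeroSets Z)
    (hG : G ∈ zeroSets Z) :
    zeroSetMass L F + zeroSetMass L G ≤ zeroSetMass L (F ∪ G) + zeroSetMass L (F ∩ G) := by
  have key : ∀ f g : Z →ᵇ ℝ, (∀ z, 0 ≤ f z) → (∀ z, 0 ≤ g z) → (∀ z ∈ F ∪ G, 1 ≤ f z) →
      (∀ z ∈ F ∩ G, 1 < g z) → zeroSetMass L F + zeroSetMass L G ≤ L f + L g := by
    intro f g f0 g0 f1 g1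
    have hdis : Disjoint (F ∩ {z | g z ≤ 1}) (G ∩ {z | g z ≤ 1}) := by
      rw [Set.disjoint_left]
      rintro z ⟨hzF, hz⟩ ⟨hzG, -⟩
      exact absurd (g1 z ⟨hzF, hzG⟩) (not_lt.mpr hz)
    obtain ⟨s, s0, s1, sF, sG⟩ := exists_separating_of_disjoint_zeroSets
      (inter_mem_zeroSets hF (setOf_le_mem_zeroSets g.continuous 1))
      (inter_mem_zeroSets hG (setOf_le_mem_zeroSets g.continuous 1)) hdis
    have hmm : ∀ z, f z ⊓ g z ≤ f z ⊔ g z := fun z => inf_le_sup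
    have hF' := hL.zeroSetMass_le (F := F) (f := f ⊓ g + (1 - s) * (f ⊔ g - f ⊓ g)) (by
        intro z
        have := le_inf (f0 z) (g0 z)
        have := mul_nonneg (sub_nonneg.mpr (s1 z)) (sub_nonneg.mpr (hmm z))
        simp only [BoundedContinuousFunction.coe_add, BoundedContinuousFunction.coe_mul,
          BoundedContinuousFunction.coe_sub, BoundedContinuousFunction.coe_inf,
          BoundedContinuousFunction.coe_sup, BoundedContinuousFunction.coe_one, Pi.add_apply,
          Pi.mul_apply, Pi.sub_apply, Pi.inf_apply, Pi.sup_apply, Pi.one_apply]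
        linarith) (by
        intro z hz
        have hfz := f1 z (Or.inl hz)
        have := mul_nonneg (sub_nonneg.mpr (s1 z)) (sub_nonneg.mpr (hmm z))
        simp only [BoundedContinuousFunction.coe_add, BoundedContinuousFunction.coe_mul,
          BoundedContinuousFunction.coe_sub, BoundedContinuousFunction.coe_inf,
          BoundedContinuousFunction.coe_sup, BoundedContinuousFunction.coe_one, Pi.add_apply,
          Pi.mul_apply, Pi.sub_apply, Pi.inf_apply, Pi.sup_apply, Pi.one_apply]
        rcases le_total (g z) 1 with hgz | hgz
        · rw [sF z ⟨hz, hgz⟩]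
          linarith [le_sup_left (a := f z) (b := g z)]
        · linarith [le_inf hfz hgz])
    have hG' := hL.zeroSetMass_le (F := G) (f := f ⊓ g + s * (f ⊔ g - f ⊓ g)) (by
        intro z
        have := le_inf (f0 z) (g0 z)
        have := mul_nonneg (s0 z) (sub_nonneg.mpr (hmm z))
        simp only [BoundedContinuousFunction.coe_add, BoundedContinuousFunction.coe_mul,
          BoundedContinuousFunction.coe_sub, BoundedContinuousFunction.coe_inf,
          BoundedContinuousFunction.coe_sup, Pi.add_apply,
          Pi.mul_apply, Pi.sub_apply, Pi.inf_apply, Pi.sup_apply]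
        linarith) (by
        intro z hz
        have hfz := f1 z (Or.inr hz)
        have := mul_nonneg (s0 z) (sub_nonneg.mpr (hmm z))
        simp only [BoundedContinuousFunction.coe_add, BoundedContinuousFunction.coe_mul,
          BoundedContinuousFunction.coe_sub, BoundedContinuousFunction.coe_inf,
          BoundedContinuousFunction.coe_sup, Pi.add_apply,
          Pi.mul_apply, Pi.sub_apply, Pi.inf_apply, Pi.sup_apply]
        rcases le_total (g z) 1 with hgz | hgz
        · rw [sG z ⟨hz, hgz⟩]
          linarith [le_sup_left (a := f z) (b := g z)]
        · linarith [le_inf hfz hgz])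
    have hsum : (f ⊓ g + (1 - s) * (f ⊔ g - f ⊓ g)) + (f ⊓ g + s * (f ⊔ g - f ⊓ g)) = f + g := by
      rw [← inf_add_sup f g]
      ring
    calc _ ≤ _ := add_le_add hF' hG'
      _ = L f + L g := by rw [← map_add, hsum, map_add]
  refine le_of_forall_pos_le_add fun ε hε => ?_
  obtain ⟨f, f0, f1, hf⟩ := hL.exists_lt_zeroSetMass_add (F ∪ G) (half_pos (half_pos hε))
  obtain ⟨g, g0, g1, hg⟩ := hL.exists_lt_zeroSetMass_add (F ∩ G) (half_pos (half_pos hε))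
  -- The constant makes the second majorant strictly larger than `1` on the intersection, as the
  -- disjointness in `key` requires.
  have := key f (g + (ε / 2) • 1) f0 (fun z => by simpa using add_nonneg (g0 z) (half_pos hε).le)
    f1 (fun z hz => by simpa using lt_add_of_le_of_pos (g1 z hz) (half_pos hε))
  rw [map_add, hL.const] at this
  linarith

/-- A zero-set is almost exhausted from outside by a disjoint zero-set. -/
theorem exists_disjoint_zeroSet (hL : IsState L) (F : Set Z) {ε : ℝ} (hε : 0 < ε) :
    ∃ G ∈ zeroSets Z, G ⊆ Fᶜ ∧ 1 - ε ≤ zeroSetMass L F + zeroSetMass L G := by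
  obtain ⟨f, f0, f1, hf⟩ := hL.exists_lt_zeroSetMass_add F (half_pos hε)
  -- If `g ≥ 0` is at least `1` on this set, then `f + ε / 2 + g ≥ 1` everywhere, which bounds `L g`
  -- from below.
  refine ⟨{z | f z + ε / 2 ≤ 1}, setOf_le_mem_zeroSets (by fun_prop) 1, ?_, ?_⟩
  · intro z hz hzF
    have := f1 z hzF
    simp only [Set.mem_ofPred_eq] at hz
    linarith
  · have : 1 - L f - ε / 2 ≤ zeroSetMass L {z | f z + ε / 2 ≤ 1} := by
      refine hL.le_zeroSetMass fun g g0 g1 => ?_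
      have : L 1 ≤ L (f + (ε / 2) • 1 + g) := hL.mono fun z => by
        rcases le_total (f z + ε / 2) 1 with hz | hz
        · have h1 := g1 z hz
          have h2 := f0 z
          simp
          linarith
        · have h2 := g0 z
          simp
          linarith
      rw [map_add, map_add, hL.const, hL.one] at this
      linarith
    linarith

theorem bddAbove_zeroSetMass (hL : IsState L) (A : Set Z) :
    BddAbove (zeroSetMass L '' {F | F ∈ zeroSets Z ∧ F ⊆ A}) :=
  ⟨1, by rintro _ ⟨F, -, rfl⟩; exact hL.zeroSetMass_le_one F⟩

theorem zeroSetMass_le_innerMass (hL : IsState L) {F A : Set Z} (hF : F ∈ zeroSets Z)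
    (h : F ⊆ A) : zeroSetMass L F ≤ innerMass L A :=
  le_csSup (hL.bddAbove_zeroSetMass A) ⟨F, ⟨hF, h⟩, rfl⟩

theorem exists_innerMass_lt (L : (Z →ᵇ ℝ) →ₗ[ℝ] ℝ) (A : Set Z) {ε : ℝ} (hε : 0 < ε) :
    ∃ F ∈ zeroSets Z, F ⊆ A ∧ innerMass L A - ε < zeroSetMass L F := by
  obtain ⟨_, ⟨F, ⟨hF, hFA⟩, rfl⟩, h⟩ := exists_lt_of_lt_csSup
    (s := zeroSetMass L '' {F | F ∈ zeroSets Z ∧ F ⊆ A})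
    ⟨_, ∅, ⟨empty_mem_zeroSets, Set.empty_subset A⟩, rfl⟩
    (show innerMass L A - ε < innerMass L A from sub_lt_self _ hε)
  exact ⟨F, hF, hFA, h⟩

theorem innerMass_le {A : Set Z} {r : ℝ}
    (h : ∀ F ∈ zeroSets Z, F ⊆ A → zeroSetMass L F ≤ r) : innerMass L A ≤ r := by
  refine le_of_forall_pos_le_add fun ε hε => ?_
  obtain ⟨F, hF, hFA, h'⟩ := exists_innerMass_lt L A hε
  linarith [h F hF hFA]

theorem innerMass_of_zeroSet (hL : IsState L) {F : Set Z} (hF : F ∈ zeroSets Z) :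
    innerMass L F = zeroSetMass L F :=
  le_antisymm (innerMass_le fun _ _ h => hL.zeroSetMass_mono h)
    (hL.zeroSetMass_le_innerMass hF subset_rfl)

theorem innerMass_empty (hL : IsState L) : innerMass L ∅ = 0 := by
  rw [hL.innerMass_of_zeroSet empty_mem_zeroSets, hL.zeroSetMass_empty]

theorem innerMass_univ (hL : IsState L) : innerMass L Set.univ = 1 := by
  rw [hL.innerMass_of_zeroSet univ_mem_zeroSets, hL.zeroSetMass_univ]

theorem innerMass_nonneg (hL : IsState L) (A : Set Z) : 0 ≤ innerMass L A :=
  (hL.zeroSetMass_nonneg ∅).trans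
    (hL.zeroSetMass_le_innerMass empty_mem_zeroSets (Set.empty_subset A))

theorem innerMass_le_one (hL : IsState L) (A : Set Z) : innerMass L A ≤ 1 :=
  innerMass_le fun F _ _ => hL.zeroSetMass_le_one F

theorem innerMass_supermodular (hL : IsState L) (A B : Set Z) :
    innerMass L A + innerMass L B ≤ innerMass L (A ∪ B) + innerMass L (A ∩ B) := by
  refine le_of_forall_pos_le_add fun ε hε => ?_
  obtain ⟨F, hF, hFA, h1⟩ := exists_innerMass_lt L A (half_pos hε)
  obtain ⟨G, hG, hGB, h2⟩ := exists_innerMass_lt L B (half_pos hε)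
  have h3 := hL.zeroSetMass_supermodular hF hG
  have h4 := hL.zeroSetMass_le_innerMass (union_mem_zeroSets hF hG) (Set.union_subset_union hFA hGB)
  have h5 := hL.zeroSetMass_le_innerMass (inter_mem_zeroSets hF hG) (Set.inter_subset_inter hFA hGB)
  linarith

theorem innerMass_add_compl_le_one (hL : IsState L) (A : Set Z) :
    innerMass L A + innerMass L Aᶜ ≤ 1 := by
  have := hL.innerMass_supermodular A Aᶜ
  rw [Set.union_compl_self, Set.inter_compl_self, hL.innerMass_empty, hL.innerMass_univ] at this
  linarith

/-- Approximate each set and its complement from inside. Both `F ∪ F'` and `G ∪ G'` have nearly full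
mass, hence so does their intersection, which lies in `(F ∪ G) ∪ (F' ∩ G')`; these two pieces sit
inside `A ∪ B` and its complement. -/
theorem innerMass_add_compl_union (hL : IsState L) {A B : Set Z}
    (hA : innerMass L A + innerMass L Aᶜ = 1) (hB : innerMass L B + innerMass L Bᶜ = 1) :
    innerMass L (A ∪ B) + innerMass L (A ∪ B)ᶜ = 1 := by
  refine le_antisymm (hL.innerMass_add_compl_le_one _) (le_of_forall_pos_le_add fun ε hε => ?_)
  have hε4 : 0 < ε / 4 := by positivity
  obtain ⟨F, hF, hFA, h1⟩ := exists_innerMass_lt L A hε4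
  obtain ⟨F', hF', hFA', h1'⟩ := exists_innerMass_lt L Aᶜ hε4
  obtain ⟨G, hG, hGB, h2⟩ := exists_innerMass_lt L B hε4
  obtain ⟨G', hG', hGB', h2'⟩ := exists_innerMass_lt L Bᶜ hε4
  have hd1 : F ∩ F' = ∅ := (Set.disjoint_of_subset hFA hFA' disjoint_compl_right).inter_eq
  have hd2 : G ∩ G' = ∅ := (Set.disjoint_of_subset hGB hGB' disjoint_compl_right).inter_eq
  have h3 := hL.zeroSetMass_supermodular hF hF'
  have h4 := hL.zeroSetMass_supermodular hG hG'
  rw [hd1, hL.zeroSetMass_empty] at h3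
  rw [hd2, hL.zeroSetMass_empty] at h4
  have h5 := hL.zeroSetMass_supermodular (union_mem_zeroSets hF hF') (union_mem_zeroSets hG hG')
  have h6 := hL.zeroSetMass_le_one (F ∪ F' ∪ (G ∪ G'))
  have h7 : zeroSetMass L ((F ∪ F') ∩ (G ∪ G')) ≤ zeroSetMass L ((F ∪ G) ∪ (F' ∩ G')) :=
    hL.zeroSetMass_mono (by
      rintro z ⟨h | h, h' | h'⟩ <;> simp [h, h'])
  have h8 := hL.zeroSetMass_union_le (F ∪ G) (F' ∩ G')
  have h9 := hL.zeroSetMass_le_innerMass (union_mem_zeroSets hF hG)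
    (Set.union_subset_union hFA hGB)
  have h10 := hL.zeroSetMass_le_innerMass (A := (A ∪ B)ᶜ) (inter_mem_zeroSets hF' hG')
    (by rw [Set.compl_union]; exact Set.inter_subset_inter hFA' hGB')
  linarith

theorem innerMass_add_compl (hL : IsState L) {A : Set Z} (hA : A ∈ zeroSetAlgebra Z) :
    innerMass L A + innerMass L Aᶜ = 1 := by
  have halg : IsSetAlgebra {A : Set Z | innerMass L A + innerMass L Aᶜ = 1} :=
    { empty_mem := by simp [hL.innerMass_empty, hL.innerMass_univ]
      compl_mem := fun s hs => by
        simp only [Set.mem_ofPred_eq, compl_compl] at hs ⊢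
        linarith
      union_mem := fun s t hs ht => hL.innerMass_add_compl_union hs ht }
  refine halg.generateSetAlgebra_subset (fun F hF => ?_) hA
  refine le_antisymm (hL.innerMass_add_compl_le_one _) (le_of_forall_pos_le_add fun ε hε => ?_)
  obtain ⟨G, hG, hGF, h⟩ := hL.exists_disjoint_zeroSet F hε
  linarith [hL.zeroSetMass_le_innerMass hF subset_rfl, hL.zeroSetMass_le_innerMass hG hGF]

/-- Supermodularity gives one inequality. Applied to the complements, whose inner masses are `1`
minus those of `A` and `B`, it gives the other. -/
theorem innerMass_union (hL : IsState L) {A B : Set Z} (hA : A ∈ zeroSetAlgebra Z)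
    (hB : B ∈ zeroSetAlgebra Z) (h : Disjoint A B) :
    innerMass L (A ∪ B) = innerMass L A + innerMass L B := by
  have h1 := hL.innerMass_supermodular A B
  rw [h.inter_eq, hL.innerMass_empty] at h1
  have h2 := hL.innerMass_supermodular Aᶜ Bᶜ
  rw [← Set.compl_union] at h2
  have h3 := hL.innerMass_le_one (Aᶜ ∪ Bᶜ)
  have h4 := hL.innerMass_add_compl hA
  have h5 := hL.innerMass_add_compl hB
  have h6 := hL.innerMass_add_compl_le_one (A ∪ B)
  exact le_antisymm (by linarith) (by linarith)

/-- The regular charge that a state determines. -/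
def charge (hL : IsState L) : ProbabilityCharge Z where
  content := isSetAlgebra_zeroSetAlgebra.isSetRing.addContent_of_union (innerMass L)
    hL.innerMass_empty fun hA hB h => hL.innerMass_union hA hB h
  nonneg A _ := hL.innerMass_nonneg A
  regular A hA ε hε := by
    obtain ⟨F, hF, hFA, h⟩ := exists_innerMass_lt L A hε
    refine ⟨F, hF, hFA, fun B hB hBA => ?_⟩
    have hd : Disjoint F B := Set.disjoint_left.mpr fun z hz hz' => (hBA hz').2 hz
    have h1 := hL.innerMass_union (zeroSets_subset_zeroSetAlgebra hF) hB hd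
    have h2 : innerMass L (F ∪ B) ≤ innerMass L A := innerMass_le fun G hG hGs =>
      hL.zeroSetMass_le_innerMass hG
        (hGs.trans (Set.union_subset hFA (hBA.trans Set.sdiff_subset)))
    rw [hL.innerMass_of_zeroSet hF] at h1
    change |innerMass L B| < ε
    rw [abs_of_nonneg (hL.innerMass_nonneg B)]
    linarith
  mass := hL.innerMass_univ

theorem charge_content (hL : IsState L) (A : Set Z) : hL.charge.content A = innerMass L A := rfl

end IsState

end Representation

/-! ### Integration against charges -/

section Integral

variable {Z : Type*} [TopologicalSpace Z]

namespace ProbabilityCharge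

variable (γ : ProbabilityCharge Z)

theorem sum_content_inter {ι : Type*} [Fintype ι] {A : ι → Set Z}
    (hA : ∀ i, A i ∈ zeroSetAlgebra Z) (hd : Pairwise (Function.onFun Disjoint A))
    (hU : (⋃ i, A i) = Set.univ) {B : Set Z} (hB : B ∈ zeroSetAlgebra Z) :
    ∑ i, γ.content (B ∩ A i) = γ.content B := by
  have h : (⋃ i, B ∩ A i) = B := by rw [← Set.inter_iUnion, hU, Set.inter_univ]
  rw [← addContent_iUnion (fun i => isSetAlgebra_zeroSetAlgebra.inter_mem hB (hA i))
    (fun i j hij => (hd hij).mono Set.inter_subset_right Set.inter_subset_right) (h.symm ▸ hB), h]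

theorem lowerSums_mono {f g : Z → ℝ} (h : ∀ z, f z ≤ g z) : γ.lowerSums f ⊆ γ.lowerSums g := by
  rintro _ ⟨n, A, a, hA, hd, hU, ha, rfl⟩
  exact ⟨n, A, a, hA, hd, hU, fun i z hz => (ha i z hz).trans (h z), rfl⟩

theorem mem_lowerSums_of_le {f : Z → ℝ} {M : ℝ} (h : ∀ z, M ≤ f z) : M ∈ γ.lowerSums f := by
  refine ⟨1, fun _ => Set.univ, fun _ => M, fun _ => isSetAlgebra_zeroSetAlgebra.univ_mem, ?_, ?_,
    fun _ z _ => h z, ?_⟩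
  · intro i j hij
    exact absurd (Subsingleton.elim i j) hij
  · exact Set.iUnion_const _
  · simp [γ.mass]

/-- Pass to the common refinement of the two partitions. With `g = -f` this compares lower sums with
upper sums. -/
theorem add_le_zero_of_mem_lowerSums {f g : Z → ℝ} (h : ∀ z, f z + g z ≤ 0) {r s : ℝ}
    (hr : r ∈ γ.lowerSums f) (hs : s ∈ γ.lowerSums g) : r + s ≤ 0 := by
  obtain ⟨n, A, a, hA, hdA, hUA, ha, rfl⟩ := hr
  obtain ⟨m, B, b, hB, hdB, hUB, hb, rfl⟩ := hs
  have h1 : ∑ i, a i * γ.content (A i) = ∑ i, ∑ j, a i * γ.content (A i ∩ B j) := by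
    refine Finset.sum_congr rfl fun i _ => ?_
    rw [← Finset.mul_sum, γ.sum_content_inter hB hdB hUB (hA i)]
  have h2 : ∑ j, b j * γ.content (B j) = ∑ i, ∑ j, b j * γ.content (A i ∩ B j) := by
    rw [Finset.sum_comm]
    refine Finset.sum_congr rfl fun j _ => ?_
    rw [← Finset.mul_sum, ← γ.sum_content_inter hA hdA hUA (hB j)]
    simp_rw [Set.inter_comm]
  rw [h1, h2, ← Finset.sum_add_distrib]
  refine Finset.sum_nonpos fun i _ => ?_
  rw [← Finset.sum_add_distrib]
  refine Finset.sum_nonpos fun j _ => ?_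
  rw [← add_mul]
  rcases (A i ∩ B j).eq_empty_or_nonempty with he | ⟨z, hzA, hzB⟩
  · simp [he]
  · exact mul_nonpos_of_nonpos_of_nonneg (by linarith [ha i z hzA, hb j z hzB, h z])
      (γ.nonneg _ (isSetAlgebra_zeroSetAlgebra.inter_mem (hA i) (hB j)))

theorem bddAbove_lowerSums {f : Z → ℝ} {M : ℝ} (h : ∀ z, f z ≤ M) : BddAbove (γ.lowerSums f) := by
  refine ⟨M, fun r hr => ?_⟩
  have := γ.add_le_zero_of_mem_lowerSums (g := fun _ => -M) (fun z => by linarith [h z]) hr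
    (γ.mem_lowerSums_of_le fun _ => le_rfl)
  linarith

theorem integral_mono {f g : Z → ℝ} {m M : ℝ} (hf : ∀ z, m ≤ f z) (hg : ∀ z, g z ≤ M)
    (h : ∀ z, f z ≤ g z) : γ.integral f ≤ γ.integral g :=
  csSup_le_csSup (γ.bddAbove_lowerSums hg) ⟨m, γ.mem_lowerSums_of_le hf⟩ (γ.lowerSums_mono h)

end ProbabilityCharge

/-- Summation by parts, which turns a lower sum over level slices into a layer-cake sum. -/
theorem sum_range_add_mul_mul_sub (h : ℕ → ℝ) (t ε : ℝ) (n : ℕ) :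
    ∑ i ∈ Finset.range n, (t + i * ε) * (h i - h (i + 1)) =
      (t - ε) * h 0 + ε * ∑ i ∈ Finset.range n, h i - (t + (n - 1) * ε) * h n := by
  induction n with
  | zero => simp; ring
  | succ n ih =>
    rw [Finset.sum_range_succ, ih, Finset.sum_range_succ]
    push_cast
    ring

namespace IsState

variable {L : (Z →ᵇ ℝ) →ₗ[ℝ] ℝ}

/-- Layer cake: the slice of `f` between two consecutive levels is at most `ε` times any majorant of
the indicator of the lower level set. -/
theorem apply_inf_le (hL : IsState L) (f : Z →ᵇ ℝ) (t : ℝ) {ε : ℝ} (hε : 0 < ε) (n : ℕ) :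
    L (f ⊓ (t + n * ε) • 1) ≤
      t + ε * ∑ i ∈ Finset.range n, zeroSetMass L {z | t + i * ε ≤ f z} := by
  induction n with
  | zero =>
    refine (hL.mono (g := t • 1) fun z => ?_).trans_eq ?_
    · simp
    · simp [hL.one]
  | succ n ih =>
    have key : (L (f ⊓ (t + (n + 1 : ℕ) * ε) • 1) - L (f ⊓ (t + n * ε) • 1)) / ε ≤
        zeroSetMass L {z | t + n * ε ≤ f z} := by
      refine hL.le_zeroSetMass fun g g0 g1 => ?_
      rw [div_le_iff₀ hε, mul_comm (L g), ← smul_eq_mul ε (L g), ← map_smul, ← map_sub]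
      refine hL.mono fun z => ?_
      simp only [BoundedContinuousFunction.coe_sub, BoundedContinuousFunction.coe_inf,
        BoundedContinuousFunction.coe_smul, BoundedContinuousFunction.coe_one, Pi.sub_apply,
        Pi.inf_apply, Pi.one_apply, smul_eq_mul, mul_one]
      push_cast
      rcases le_total (t + n * ε) (f z) with hz | hz
      · have h1 := mul_le_mul_of_nonneg_left (g1 z hz) hε.le
        have h2 : f z ⊓ (t + (n + 1) * ε) ≤ t + (n + 1) * ε := inf_le_right
        rw [inf_eq_right.mpr hz]
        linarith
      · have h1 := mul_nonneg hε.le (g0 z)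
        have h2 : f z ⊓ (t + (n + 1) * ε) ≤ f z := inf_le_left
        rw [inf_eq_left.mpr hz]
        linarith
    rw [div_le_iff₀ hε] at key
    rw [Finset.sum_range_succ]
    linarith

theorem exists_mem_lowerSums (hL : IsState L) (f : Z →ᵇ ℝ) {ε : ℝ} (hε : 0 < ε) :
    ∃ r ∈ hL.charge.lowerSums f, L f - ε ≤ r := by
  have hb : ∀ z, -‖f‖ ≤ f z ∧ f z ≤ ‖f‖ := fun z => abs_le.mp (f.norm_coe_le_norm z)
  -- With this many steps of size `ε` the levels from `-‖f‖` pass `‖f‖`, so the last level set is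
  -- empty.
  obtain ⟨n, hn⟩ := exists_nat_gt ((2 * ‖f‖) / ε)
  rw [div_lt_iff₀ hε] at hn
  set t := -‖f‖ with ht
  let H : ℕ → Set Z := fun i => {z | t + i * ε ≤ f z}
  have hH : ∀ i, H i ∈ zeroSets Z := fun i => setOf_ge_mem_zeroSets f.continuous _
  have hanti : Antitone H := fun i j hij z (hz : t + j * ε ≤ f z) => by
    change t + i * ε ≤ f z
    have : (i : ℝ) * ε ≤ j * ε := by gcongr
    linarith
  have hH0 : H 0 = Set.univ := Set.eq_univ_of_forall fun z => by
    change t + (0 : ℕ) * ε ≤ f z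
    simpa using (hb z).1
  have hHn : H n = ∅ := Set.eq_empty_of_forall_notMem fun z (hz : t + n * ε ≤ f z) => by
    linarith [(hb z).2]
  have hHalg := fun i => zeroSets_subset_zeroSetAlgebra (hH i)
  have hA : ∀ i, H i \ H (i + 1) ∈ zeroSetAlgebra Z := fun i =>
    isSetAlgebra_zeroSetAlgebra.sdiff_mem (hHalg i) (hHalg (i + 1))
  have hmass : ∀ i, innerMass L (H i \ H (i + 1)) =
      zeroSetMass L (H i) - zeroSetMass L (H (i + 1)) := by
    intro i
    have := hL.innerMass_union (hHalg (i + 1)) (hA i) disjoint_sdiff_self_right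
    rw [Set.union_sdiff_cancel (hanti i.le_succ), hL.innerMass_of_zeroSet (hH i),
      hL.innerMass_of_zeroSet (hH (i + 1))] at this
    linarith
  refine ⟨_, ⟨n, fun i => H i \ H (i + 1), fun i => t + (i : ℕ) * ε, fun i => hA i, ?_, ?_,
    fun i z hz => hz.1, rfl⟩, ?_⟩
  · have : ∀ i j : Fin n, (i : ℕ) < j → Disjoint (H i \ H (i + 1)) (H j \ H (j + 1)) := by
      intro i j hij
      exact Set.disjoint_left.mpr fun z hz hz' => hz.2 (hanti (Nat.succ_le_of_lt hij) hz'.1)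
    intro i j hij
    rcases lt_or_gt_of_ne (Fin.val_ne_of_ne hij) with h | h
    · exact this i j h
    · exact (this j i h).symm
  · refine Set.eq_univ_of_forall fun z => ?_
    have hex : ∃ k, z ∉ H k := ⟨n, by simp [hHn]⟩
    classical
    have hk := Nat.find_spec hex
    have hkn : Nat.find hex ≤ n := Nat.find_min' hex (by simp [hHn])
    obtain ⟨k, hk'⟩ := Nat.exists_eq_succ_of_ne_zero
      (fun h0 => by rw [h0, hH0] at hk; exact hk trivial : Nat.find hex ≠ 0)
    refine Set.mem_iUnion.mpr ⟨⟨k, by omega⟩, ?_, ?_⟩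
    · by_contra hz
      have := Nat.find_min' hex (m := k) hz
      omega
    · rw [hk'] at hk
      exact hk
  · have h1 : ∑ i : Fin n, (t + (i : ℕ) * ε) * hL.charge.content (H i \ H (i + 1)) =
        ∑ i ∈ Finset.range n,
          (t + i * ε) * (zeroSetMass L (H i) - zeroSetMass L (H (i + 1))) := by
      rw [← Fin.sum_univ_eq_sum_range
        (fun i => (t + i * ε) * (zeroSetMass L (H i) - zeroSetMass L (H (i + 1))))]
      simp_rw [charge_content, hmass]
    -- The boundary term `(t - ε) * 1` accounts for exactly the permitted loss `ε`.
    rw [h1, sum_range_add_mul_mul_sub (fun i => zeroSetMass L (H i)), hHn, hH0,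
      hL.zeroSetMass_empty, hL.zeroSetMass_univ]
    have h2 := hL.apply_inf_le f t hε n
    have h3 : f ⊓ (t + n * ε) • 1 = f := inf_eq_left.mpr fun z => by
      simp
      linarith [(hb z).2]
    rw [h3] at h2
    linarith

/-- A state is integration against its charge. -/
theorem integral_charge (hL : IsState L) (f : Z →ᵇ ℝ) : hL.charge.integral f = L f := by
  have hb : ∀ (f : Z →ᵇ ℝ) z, f z ≤ ‖f‖ := fun f z => (abs_le.mp (f.norm_coe_le_norm z)).2
  obtain ⟨r, hr, -⟩ := hL.exists_mem_lowerSums f one_pos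
  refine le_antisymm (csSup_le ⟨r, hr⟩ fun s hs => ?_) ?_
  · refine le_of_forall_pos_le_add fun ε hε => ?_
    -- A lower sum for `-f` is the negative of an upper sum for `f`.
    obtain ⟨r, hr, h⟩ := hL.exists_mem_lowerSums (-f) hε
    have := hL.charge.add_le_zero_of_mem_lowerSums (fun z => by simp) hs hr
    rw [map_neg] at h
    linarith
  · refine le_of_forall_pos_le_add fun ε hε => ?_
    obtain ⟨r, hr, h⟩ := hL.exists_mem_lowerSums f hε
    have : r ≤ hL.charge.integral f := le_csSup (hL.charge.bddAbove_lowerSums (hb f)) hr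
    linarith

end IsState

end Integral

/-! ### Continuous functions are Baire measurable -/

section BaireMeasures

variable {X : Type*} [TopologicalSpace X] [MeasurableSpace X] [BaireSigmaAlgebra X]

theorem measurable_of_continuous {f : X → ℝ} (hf : Continuous f) : Measurable f := by
  refine measurable_of_Iic fun a => ?_
  rw [BaireSigmaAlgebra.measurable_eq (X := X)]
  exact MeasurableSpace.measurableSet_generateFrom (setOf_le_mem_zeroSets hf a)

theorem integrable_boundedContinuous (μ : Measure X) [IsFiniteMeasure μ] (f : X →ᵇ ℝ) :
    Integrable f μ :=
  Integrable.of_bound (measurable_of_continuous f.continuous).aestronglyMeasurable ‖f‖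
    (Eventually.of_forall f.norm_coe_le_norm)

end BaireMeasures

/-! ### Compactness of equi-Lipschitz sequences under separable measures -/

section Equicontinuity

/-- The diagonal argument, in the form of sequential compactness of a countable power of `[-C, C]`.
-/
theorem exists_subseq_tendsto_of_countable {X : Type*} {D : Set X} (hD : D.Countable) {f : ℕ → X → ℝ} {C : ℝ}
    (hC : ∀ n x, |f n x| ≤ C) :
    ∃ κ : ℕ → ℕ, StrictMono κ ∧ ∀ a ∈ D, ∃ l, Tendsto (fun n => f (κ n) a) atTop (𝓝 l) := by
  have := hD.to_subtype
  obtain ⟨l, -, κ, hκ, h⟩ := (isCompact_univ_pi fun _ : D => isCompact_Icc (a := -C) (b := C))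
    |>.tendsto_subseq (x := fun n (a : D) => f n a) (fun n a _ => abs_le.mp (hC n a))
  exact ⟨κ, hκ, fun a ha => ⟨l ⟨a, ha⟩, (tendsto_pi_nhds.mp h) ⟨a, ha⟩⟩⟩

variable {X : Type*} [TopologicalSpace X] {d : X → X → ℝ}

theorem IsBoundedContinuousPseudometric.continuous_of_abs_sub_le
    (hd : IsBoundedContinuousPseudometric d) {f : X → ℝ} (hf : ∀ x x', |f x - f x'| ≤ d x x') :
    Continuous f := by
  rw [continuous_iff_continuousAt]
  intro x₀
  have h : Tendsto (fun x => d x x₀) (𝓝 x₀) (𝓝 0) := by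
    have := (hd.continuous.comp (Continuous.prodMk continuous_id continuous_const :
      Continuous fun x => (x, x₀))).tendsto x₀
    simpa [Function.comp_def, hd.self] using this
  rw [ContinuousAt, tendsto_iff_dist_tendsto_zero]
  exact squeeze_zero (fun _ => dist_nonneg) (fun x => hf x x₀) h

/-- A uniformly bounded and uniformly Lipschitz sequence has an almost everywhere convergent
subsequence with respect to a separable measure. -/
theorem IsSeparableMeasure.exists_subseq_tendsto_ae [MeasurableSpace X] {μ : Measure X}
    (hμ : IsSeparableMeasure μ) (hd : IsBoundedContinuousPseudometric d) {f : ℕ → X → ℝ} {C : ℝ}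
    (hC : ∀ n x, |f n x| ≤ C) (hf : ∀ n x x', |f n x - f n x'| ≤ d x x') :
    ∃ κ : ℕ → ℕ, StrictMono κ ∧
      ∀ᵐ x ∂μ, ∃ l, Tendsto (fun n => f (κ n) x) atTop (𝓝 l) := by
  obtain ⟨S, hS, D, -, hDc, hDS⟩ := hμ d hd
  obtain ⟨κ, hκ, hconv⟩ := exists_subseq_tendsto_of_countable hDc hC
  refine ⟨κ, hκ, ?_⟩
  filter_upwards [mem_ae_iff.mpr hS] with x hx
  refine cauchySeq_tendsto_of_complete (Metric.cauchySeq_iff.mpr fun ε hε => ?_)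
  obtain ⟨a, haD, ha⟩ := hDS x hx (ε / 3) (by positivity)
  obtain ⟨l, hl⟩ := hconv a haD
  obtain ⟨N, hN⟩ := Metric.cauchySeq_iff.mp hl.cauchySeq (ε / 3) (by positivity)
  refine ⟨N, fun m hm n hn => ?_⟩
  have h1 := hN m hm n hn
  have h2 := (hf (κ m) x a).trans_lt ha
  have h3 := (hf (κ n) x a).trans_lt ha
  rw [Real.dist_eq] at h1 ⊢
  rw [abs_lt] at *
  constructor <;> linarith [h1.1, h1.2, h2.1, h2.2, h3.1, h3.2]

theorem exists_tendsto_ultrafilter {ι : Type*} (u : Ultrafilter ι) {f : ι → ℝ} {C : ℝ}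
    (hC : ∀ n, |f n| ≤ C) : ∃ l, |l| ≤ C ∧ Tendsto f u (𝓝 l) := by
  obtain ⟨l, hl, h⟩ := (isCompact_Icc (a := -C) (b := C)).ultrafilter_le_nhds (u.map f)
    (le_principal_iff.mpr (u.mem_map.mpr (univ_mem' fun n => abs_le.mp (hC n))))
  exact ⟨l, abs_le.mpr hl, h⟩

/-- The pointwise limit along an ultrafilter of a uniformly bounded and uniformly Lipschitz
sequence that converges almost everywhere: its integral is the limit of the integrals. -/
theorem exists_ultrafilter_limit [MeasurableSpace X] [BaireSigmaAlgebra X] {μ : Measure X}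
    [IsProbabilityMeasure μ] (hd : IsBoundedContinuousPseudometric d) {f : ℕ → X →ᵇ ℝ} {C : ℝ}
    (hC : ∀ n x, |f n x| ≤ C) (hf : ∀ n x x', |f n x - f n x'| ≤ d x x')
    (hconv : ∀ᵐ x ∂μ, ∃ l, Tendsto (fun n => f n x) atTop (𝓝 l)) :
    ∃ g : X →ᵇ ℝ, (∀ x, Tendsto (fun n => f n x) (hyperfilter ℕ) (𝓝 (g x))) ∧
      Tendsto (fun n => ∫ x, f n x ∂μ) atTop (𝓝 (∫ x, g x ∂μ)) := by
  -- The ultrafilter limit exists also on the exceptional null set, so the Lipschitz bound, and with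
  -- it continuity, holds everywhere. It agrees with the ordinary limit wherever that exists.
  choose g hgC hg using fun x => exists_tendsto_ultrafilter (hyperfilter ℕ) fun n => hC n x
  have hgd : ∀ x x', |g x - g x'| ≤ d x x' := fun x x' =>
    le_of_tendsto ((hg x).sub (hg x')).abs (Eventually.of_forall fun n => hf n x x')
  refine ⟨BoundedContinuousFunction.ofNormedAddCommGroup g (hd.continuous_of_abs_sub_le hgd) C
    hgC, hg, ?_⟩
  refine tendsto_integral_of_dominated_convergence (fun _ => C)
    (fun n => (integrable_boundedContinuous μ (f n)).aestronglyMeasurable) (integrable_const C)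
    (fun n => Eventually.of_forall (hC n)) ?_
  filter_upwards [hconv] with x ⟨l, hl⟩
  have : l = g x := tendsto_nhds_unique (hl.mono_left Nat.hyperfilter_le_atTop) (hg x)
  rw [this] at hl
  exact hl

end Equicontinuity

/-! ### The cost pseudometric and c-transforms -/

section Transforms

variable {X Y : Type*}

/-- The pseudometric `sup_y |c(x, y) - c(x', y)|`. -/
def costDist (c : X × Y → ℝ) (x x' : X) : ℝ :=
  ⨆ y, |c (x, y) - c (x', y)|

variable {c : X × Y → ℝ} {M : ℝ}

theorem abs_sub_le_costDist (hc : ∀ p, |c p| ≤ M) (x x' : X) (y : Y) :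
    |c (x, y) - c (x', y)| ≤ costDist c x x' :=
  le_ciSup (f := fun y => |c (x, y) - c (x', y)|)
    ⟨M + M, by rintro _ ⟨y, rfl⟩; exact (abs_sub _ _).trans (add_le_add (hc _) (hc _))⟩ y

theorem costDist_triangle [Nonempty Y] (hc : ∀ p, |c p| ≤ M) (x y z : X) :
    costDist c x z ≤ costDist c x y + costDist c y z :=
  ciSup_le fun w => (abs_sub_le _ (c (y, w)) _).trans
    (add_le_add (abs_sub_le_costDist hc x y w) (abs_sub_le_costDist hc y z w))

theorem costDist_comm (x x' : X) : costDist c x x' = costDist c x' x := by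
  simp only [costDist, abs_sub_comm]

/-- Property (H) is continuity at the diagonal in one variable; the triangle inequality upgrades it
to joint continuity. -/
theorem isBoundedContinuousPseudometric_costDist [TopologicalSpace X] [Nonempty Y]
    (hc : ∀ p, |c p| ≤ M)
    (hH : ∀ x₀ : X, Tendsto (fun x => ⨆ y, |c (x, y) - c (x₀, y)|) (𝓝 x₀) (𝓝 0)) :
    IsBoundedContinuousPseudometric (costDist c) where
  nonneg x y := Real.iSup_nonneg fun _ => abs_nonneg _
  self x := by simp [costDist]
  symm := costDist_comm
  triangle := costDist_triangle hc
  bounded := ⟨M + M, fun x y => ciSup_le fun w =>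
    (abs_sub _ _).trans (add_le_add (hc _) (hc _))⟩
  continuous := by
    rw [continuous_iff_continuousAt]
    rintro ⟨x₀, y₀⟩
    have h1 : Tendsto (fun p : X × X => costDist c p.1 x₀) (𝓝 (x₀, y₀)) (𝓝 0) :=
      (hH x₀).comp continuousAt_fst
    have h2 : Tendsto (fun p : X × X => costDist c p.2 y₀) (𝓝 (x₀, y₀)) (𝓝 0) :=
      (hH y₀).comp continuousAt_snd
    rw [ContinuousAt, tendsto_iff_dist_tendsto_zero]
    refine squeeze_zero (fun _ => dist_nonneg) (fun p => ?_) (by simpa using h1.add h2)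
    rw [Real.dist_eq, abs_le]
    have t1 := costDist_triangle hc p.1 x₀ p.2
    have t2 := costDist_triangle hc x₀ y₀ p.2
    have t3 := costDist_triangle hc x₀ p.1 y₀
    have t4 := costDist_triangle hc p.1 p.2 y₀
    rw [costDist_comm (c := c) y₀ p.2] at t2
    rw [costDist_comm (c := c) x₀ p.1] at t3
    constructor <;> linarith

theorem cTransform_le (hc : ∀ p, |c p| ≤ M) {ξ : X → ℝ} {K : ℝ} (hξ : ∀ x, |ξ x| ≤ K) (x : X)
    (y : Y) : cTransform c ξ y ≤ c (x, y) - ξ x :=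
  ciInf_le (f := fun x => c (x, y) - ξ x) ⟨-M - K, by
    rintro _ ⟨x, rfl⟩
    have h1 := (abs_le.mp (hc (x, y))).1
    have h2 := (abs_le.mp (hξ x)).2
    change -M - K ≤ c (x, y) - ξ x
    linarith⟩ x

theorem abs_cTransform_le [Nonempty X] (hc : ∀ p, |c p| ≤ M) {ξ : X → ℝ} {K : ℝ}
    (hξ : ∀ x, |ξ x| ≤ K) (y : Y) : |cTransform c ξ y| ≤ M + K := by
  obtain ⟨x₀⟩ := ‹Nonempty X›
  refine abs_le.mpr ⟨le_ciInf fun x => ?_, (cTransform_le hc hξ x₀ y).trans ?_⟩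
  · linarith [(abs_le.mp (hc (x, y))).1, (abs_le.mp (hξ x)).2]
  · linarith [(abs_le.mp (hc (x₀, y))).2, (abs_le.mp (hξ x₀)).1]

theorem cTransform_sub_le [Nonempty X] (hc : ∀ p, |c p| ≤ M) {ξ : X → ℝ} {K : ℝ}
    (hξ : ∀ x, |ξ x| ≤ K) {y y' : Y} {r : ℝ} (h : ∀ x, c (x, y) - c (x, y') ≤ r) :
    cTransform c ξ y - cTransform c ξ y' ≤ r := by
  have : cTransform c ξ y - r ≤ cTransform c ξ y' := le_ciInf fun x => by
    linarith [cTransform_le hc hξ x y, h x]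
  linarith

/-- An infimum of functions with a common modulus keeps that modulus. The bound does not involve
`ξ`, which is the source of equicontinuity. -/
theorem abs_cTransform_sub_le [Nonempty X] (hc : ∀ p, |c p| ≤ M) {ξ : X → ℝ} {K : ℝ}
    (hξ : ∀ x, |ξ x| ≤ K) (y y' : Y) :
    |cTransform c ξ y - cTransform c ξ y'| ≤ costDist (c ∘ Prod.swap) y y' := by
  have h : ∀ x, |c (x, y) - c (x, y')| ≤ costDist (c ∘ Prod.swap) y y' := fun x =>
    abs_sub_le_costDist (c := c ∘ Prod.swap) (fun p => hc p.swap) y y' x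
  refine abs_sub_le_iff.mpr ⟨cTransform_sub_le hc hξ fun x => (abs_sub_le_iff.mp (h x)).1,
    cTransform_sub_le hc hξ fun x => (abs_sub_le_iff.mp (h x)).2⟩

theorem cBarTransform_add_le (hc : ∀ p, |c p| ≤ M) {ζ : Y → ℝ} {K : ℝ} (hζ : ∀ y, |ζ y| ≤ K)
    (x : X) (y : Y) : cBarTransform c ζ x + ζ y ≤ c (x, y) := by
  -- `cBarTransform c` unfolds to `cTransform (c ∘ Prod.swap)`, so each estimate serves both sides.
  have := cTransform_le (c := c ∘ Prod.swap) (fun p => hc p.swap) hζ y x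
  change cBarTransform c ζ x ≤ c (x, y) - ζ y at this
  linarith

variable [TopologicalSpace X] [TopologicalSpace Y]

/-- The transform of a bounded continuous function is bounded and continuous. -/
theorem exists_boundedContinuous_cTransform [Nonempty X] (hc : ∀ p, |c p| ≤ M)
    (hd : IsBoundedContinuousPseudometric (costDist (c ∘ Prod.swap))) (ξ : X →ᵇ ℝ) :
    ∃ ψ : Y →ᵇ ℝ, (ψ : Y → ℝ) = cTransform c ξ :=
  ⟨BoundedContinuousFunction.ofNormedAddCommGroup (cTransform c ξ)
    (hd.continuous_of_abs_sub_le (abs_cTransform_sub_le hc ξ.norm_coe_le_norm)) (M + ‖ξ‖)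
    (abs_cTransform_le hc ξ.norm_coe_le_norm), rfl⟩

theorem exists_boundedContinuous_cBarTransform [Nonempty Y] (hc : ∀ p, |c p| ≤ M)
    (hd : IsBoundedContinuousPseudometric (costDist c)) (ζ : Y →ᵇ ℝ) :
    ∃ φ : X →ᵇ ℝ, (φ : X → ℝ) = cBarTransform c ζ :=
  exists_boundedContinuous_cTransform (c := c ∘ Prod.swap) (fun p => hc p.swap) hd ζ

theorem dualAdmissible_nonempty (hc : ∀ p, |c p| ≤ M) : (dualAdmissible c).Nonempty :=
  ⟨(BoundedContinuousFunction.const X (-M), 0), fun x y => by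
    simpa using (abs_le.mp (hc (x, y))).1⟩

end Transforms

/-! ### Existence of dual optimizers -/

section Dual

variable {X Y : Type*} [TopologicalSpace X] [TopologicalSpace Y] [MeasurableSpace X]
  [MeasurableSpace Y] [BaireSigmaAlgebra X] [BaireSigmaAlgebra Y] {c : X × Y → ℝ} {M : ℝ}

theorem dualObjective_mono (μ : Measure X) [IsProbabilityMeasure μ] (ν : Measure Y)
    [IsProbabilityMeasure ν] {q q' : (X →ᵇ ℝ) × (Y →ᵇ ℝ)} (h1 : ∀ x, q.1 x ≤ q'.1 x)
    (h2 : ∀ y, q.2 y ≤ q'.2 y) : dualObjective μ ν q ≤ dualObjective μ ν q' :=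
  add_le_add
    (integral_mono (integrable_boundedContinuous μ _) (integrable_boundedContinuous μ _) h1)
    (integral_mono (integrable_boundedContinuous ν _) (integrable_boundedContinuous ν _) h2)

/-- Integrate in `y` for fixed `x`, then in `x`; no product measure is needed. -/
theorem dualObjective_le_of_add_le (μ : Measure X) [IsProbabilityMeasure μ] (ν : Measure Y)
    [IsProbabilityMeasure ν] {q : (X →ᵇ ℝ) × (Y →ᵇ ℝ)} {a : ℝ}
    (h : ∀ x y, q.1 x + q.2 y ≤ a) : dualObjective μ ν q ≤ a := by
  have h1 : ∀ x, q.1 x ≤ a - ∫ y, q.2 y ∂ν := by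
    intro x
    have := integral_mono (integrable_boundedContinuous ν q.2) (integrable_const (a - q.1 x))
      (fun y => by linarith [h x y])
    simp only [integral_const, probReal_univ, smul_eq_mul, one_mul] at this
    linarith
  have := integral_mono (integrable_boundedContinuous μ q.1)
    (integrable_const (a - ∫ y, q.2 y ∂ν)) h1
  simp only [integral_const, probReal_univ, smul_eq_mul, one_mul] at this
  unfold dualObjective
  linarith

/-- Admissible pairs can be improved to uniformly bounded, uniformly Lipschitz ones. -/
theorem exists_improved_admissible [Nonempty X] [Nonempty Y] (hc : ∀ p, |c p| ≤ M)
    (hdX : IsBoundedContinuousPseudometric (costDist c))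
    (hdY : IsBoundedContinuousPseudometric (costDist (c ∘ Prod.swap)))
    (μ : Measure X) [IsProbabilityMeasure μ] (ν : Measure Y) [IsProbabilityMeasure ν]
    {q : (X →ᵇ ℝ) × (Y →ᵇ ℝ)} (hq : q ∈ dualAdmissible c) :
    ∃ q' ∈ dualAdmissible c, dualObjective μ ν q ≤ dualObjective μ ν q' ∧
      (∀ x, |q'.1 x| ≤ M + (M + M)) ∧ (∀ y, |q'.2 y| ≤ M + M) ∧
      (∀ x x', |q'.1 x - q'.1 x'| ≤ costDist c x x') ∧
      ∀ y y', |q'.2 y - q'.2 y'| ≤ costDist (c ∘ Prod.swap) y y' := by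
  obtain ⟨ψ, hψ⟩ := exists_boundedContinuous_cTransform hc hdY q.1
  obtain ⟨y₀⟩ := id ‹Nonempty Y›
  have hosc : ∀ y y', ψ y - ψ y' ≤ M + M := by
    intro y y'
    rw [hψ]
    refine cTransform_sub_le hc q.1.norm_coe_le_norm fun x => ?_
    linarith [(abs_le.mp (hc (x, y))).2, (abs_le.mp (hc (x, y'))).1]
  -- The transform oscillates by at most `2M`, but its size depends on `q.1`. Subtracting its value
  -- at `y₀` gives a uniform bound; the transform of `ψ'` absorbs the constant, so the objective
  -- does not suffer.
  let ψ' : Y →ᵇ ℝ := ψ - BoundedContinuousFunction.const Y (ψ y₀)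
  have hψ' : ∀ y, ψ' y = ψ y - ψ y₀ := fun y => rfl
  have hbd : ∀ y, |ψ' y| ≤ M + M := fun y => by
    rw [hψ']
    exact abs_sub_le_iff.mpr ⟨hosc _ _, hosc _ _⟩
  obtain ⟨φ', hφ'⟩ := exists_boundedContinuous_cBarTransform hc hdX ψ'
  refine ⟨(φ', ψ'), fun x y => ?_, ?_, fun x => ?_, hbd, fun x x' => ?_, fun y y' => ?_⟩
  · change φ' x + ψ' y ≤ c (x, y)
    rw [hφ']
    exact cBarTransform_add_le hc hbd x y
  · have h1 : ∀ x, q.1 x + ψ y₀ ≤ φ' x := fun x => by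
      rw [hφ']
      refine le_ciInf fun y => ?_
      have := cTransform_le hc q.1.norm_coe_le_norm x y
      rw [← hψ] at this
      rw [hψ']
      linarith
    have h2 : ∀ y, q.2 y - ψ y₀ ≤ ψ' y := fun y => by
      rw [hψ', hψ]
      refine sub_le_sub_right (le_ciInf fun x => ?_) _
      linarith [hq x y]
    have h3 := dualObjective_mono μ ν (q := (q.1 + BoundedContinuousFunction.const X (ψ y₀),
      q.2 - BoundedContinuousFunction.const Y (ψ y₀))) (q' := (φ', ψ')) h1 h2
    refine le_trans (le_of_eq ?_) h3
    simp only [dualObjective, BoundedContinuousFunction.coe_add, BoundedContinuousFunction.coe_sub,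
      Pi.add_apply, Pi.sub_apply, BoundedContinuousFunction.const_apply]
    rw [integral_add (integrable_boundedContinuous μ _) (integrable_const _),
      integral_sub (integrable_boundedContinuous ν _) (integrable_const _)]
    simp
  · change |φ' x| ≤ _
    rw [hφ']
    exact abs_cTransform_le (c := c ∘ Prod.swap) (fun p => hc p.swap) hbd x
  · change |φ' x - φ' x'| ≤ _
    rw [hφ']
    exact abs_cTransform_sub_le (c := c ∘ Prod.swap) (fun p => hc p.swap) hbd x x'
  · change |ψ' y - ψ' y'| ≤ _
    rw [hψ', hψ', sub_sub_sub_cancel_right, hψ]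
    exact abs_cTransform_sub_le hc q.1.norm_coe_le_norm y y'

theorem bddAbove_dualObjective (hc : ∀ p, |c p| ≤ M) (μ : Measure X) [IsProbabilityMeasure μ]
    (ν : Measure Y) [IsProbabilityMeasure ν] :
    BddAbove (dualObjective μ ν '' dualAdmissible c) := by
  refine ⟨M, ?_⟩
  rintro _ ⟨q, hq, rfl⟩
  exact dualObjective_le_of_add_le μ ν fun x y => (hq x y).trans (abs_le.mp (hc _)).2

/-- The dual problem has a solution. -/
theorem exists_isMaxOn_dualObjective [Nonempty X] [Nonempty Y] (hc : ∀ p, |c p| ≤ M)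
    (hdX : IsBoundedContinuousPseudometric (costDist c))
    (hdY : IsBoundedContinuousPseudometric (costDist (c ∘ Prod.swap)))
    (μ : Measure X) [IsProbabilityMeasure μ] (hμ : IsSeparableMeasure μ)
    (ν : Measure Y) [IsProbabilityMeasure ν] (hν : IsSeparableMeasure ν) :
    ∃ q ∈ dualAdmissible c, ∀ q' ∈ dualAdmissible c, dualObjective μ ν q' ≤ dualObjective μ ν q := by
  have hbdd := bddAbove_dualObjective hc μ ν
  obtain ⟨u, -, hu, hmem⟩ := exists_seq_tendsto_sSup
    ((dualAdmissible_nonempty hc).image (dualObjective μ ν)) hbdd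
  choose q₀ hq₀ hq₀u using hmem
  choose q hq hle hb1 hb2 hl1 hl2 using fun n =>
    exists_improved_admissible hc hdX hdY μ ν (hq₀ n)
  obtain ⟨κ, hκ, hconv1⟩ := hμ.exists_subseq_tendsto_ae hdX hb1 hl1
  obtain ⟨ρ, hρ, hconv2⟩ := hν.exists_subseq_tendsto_ae hdY (fun n => hb2 (κ n))
    (fun n => hl2 (κ n))
  have hτ : Tendsto (κ ∘ ρ) atTop atTop := (hκ.comp hρ).tendsto_atTop
  obtain ⟨φ, hφ, hφi⟩ := exists_ultrafilter_limit (μ := μ) hdX (f := fun n => (q (κ (ρ n))).1)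
    (fun n => hb1 _) (fun n => hl1 _)
    (hconv1.mono fun x ⟨l, hl⟩ => ⟨l, hl.comp hρ.tendsto_atTop⟩)
  obtain ⟨ψ, hψ, hψi⟩ := exists_ultrafilter_limit (μ := ν) hdY (f := fun n => (q (κ (ρ n))).2)
    (fun n => hb2 _) (fun n => hl2 _) hconv2
  refine ⟨(φ, ψ), fun x y => ?_, fun q' hq' => ?_⟩
  · exact le_of_tendsto ((hφ x).add (hψ y)) (Eventually.of_forall fun n => hq _ x y)
  · refine (le_csSup hbdd ⟨q', hq', rfl⟩).trans ?_
    refine le_of_tendsto_of_tendsto (hu.comp hτ) (hφi.add hψi) (Eventually.of_forall fun n => ?_)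
    change u (κ (ρ n)) ≤ dualObjective μ ν (q (κ (ρ n)))
    rw [← hq₀u]
    exact hle _

end Dual

/-! ### Weak duality, and a primal state from a dual bound -/

section Duality

variable {X Y : Type*} [TopologicalSpace X] [TopologicalSpace Y]

/-- The function `φ(x) + ψ(y)` on the product. -/
def separatedSum (q : (X →ᵇ ℝ) × (Y →ᵇ ℝ)) : X × Y →ᵇ ℝ :=
  q.1.compContinuous ⟨Prod.fst, continuous_fst⟩ + q.2.compContinuous ⟨Prod.snd, continuous_snd⟩

theorem separatedSum_apply (q : (X →ᵇ ℝ) × (Y →ᵇ ℝ)) (p : X × Y) :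
    separatedSum q p = q.1 p.1 + q.2 p.2 := rfl

theorem PropertyH.continuous {c : X × Y → ℝ} {M : ℝ} (hc : ∀ p, |c p| ≤ M) (hH : PropertyH c) :
    Continuous c := by
  rw [continuous_iff_continuousAt]
  rintro ⟨x₀, y₀⟩
  have h1 : Tendsto (fun p : X × Y => costDist c p.1 x₀) (𝓝 (x₀, y₀)) (𝓝 0) :=
    (hH.1 x₀).comp continuousAt_fst
  have h2 : Tendsto (fun p : X × Y => costDist (c ∘ Prod.swap) p.2 y₀) (𝓝 (x₀, y₀)) (𝓝 0) :=
    (hH.2 y₀).comp continuousAt_snd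
  rw [ContinuousAt, tendsto_iff_dist_tendsto_zero]
  refine squeeze_zero (fun _ => dist_nonneg) (fun p => ?_) (by simpa using h1.add h2)
  rw [Real.dist_eq]
  exact (abs_sub_le _ (c (x₀, p.2)) _).trans (add_le_add (abs_sub_le_costDist hc p.1 x₀ p.2)
    (abs_sub_le_costDist (c := c ∘ Prod.swap) (fun p => hc p.swap) p.2 y₀ x₀))

variable [MeasurableSpace X] [MeasurableSpace Y] (μ : Measure X) (ν : Measure Y)

theorem dualObjective_smul (a : ℝ) (q : (X →ᵇ ℝ) × (Y →ᵇ ℝ)) :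
    dualObjective μ ν (a • q) = a * dualObjective μ ν q := by
  simp only [dualObjective, Prod.smul_fst, Prod.smul_snd, BoundedContinuousFunction.coe_smul,
    smul_eq_mul, integral_const_mul]
  ring

theorem dualObjective_const [IsProbabilityMeasure μ] (a : ℝ) :
    dualObjective μ ν (BoundedContinuousFunction.const X a, 0) = a := by
  simp [dualObjective]

/-- Weak duality. -/
theorem dualObjective_le_integral {c : X × Y → ℝ} {M : ℝ} (hc : ∀ p, |c p| ≤ M)
    {γ : ProbabilityCharge (X × Y)} (hγ : γ ∈ plans μ ν) {q : (X →ᵇ ℝ) × (Y →ᵇ ℝ)}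
    (hq : q ∈ dualAdmissible c) : dualObjective μ ν q ≤ γ.integral c :=
  (hγ q.1 q.2).symm.trans_le <| γ.integral_mono
    (fun p => (abs_le.mp ((separatedSum q).norm_coe_le_norm p)).1)
    (fun p => (abs_le.mp (hc p)).2) fun p => hq p.1 p.2

variable [BaireSigmaAlgebra X] [BaireSigmaAlgebra Y] [IsProbabilityMeasure μ]
  [IsProbabilityMeasure ν]

theorem dualObjective_add (q q' : (X →ᵇ ℝ) × (Y →ᵇ ℝ)) :
    dualObjective μ ν (q + q') = dualObjective μ ν q + dualObjective μ ν q' := by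
  simp only [dualObjective, Prod.fst_add, Prod.snd_add, BoundedContinuousFunction.coe_add,
    Pi.add_apply]
  rw [integral_add (integrable_boundedContinuous μ _) (integrable_boundedContinuous μ _),
    integral_add (integrable_boundedContinuous ν _) (integrable_boundedContinuous ν _)]
  ring

/-- The functions that dominate `φ(x) + ψ(y) + t (V - c(x, y))` for some `t ≥ 0` and some pair
`(φ, ψ)` of vanishing total integral. -/
def dualCone (c : X × Y → ℝ) (V : ℝ) : PointedCone ℝ (X × Y →ᵇ ℝ) where
  carrier := {f | ∃ (q : (X →ᵇ ℝ) × (Y →ᵇ ℝ)) (t : ℝ), 0 ≤ t ∧ dualObjective μ ν q = 0 ∧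
    ∀ p, separatedSum q p + t * (V - c p) ≤ f p}
  add_mem' := by
    rintro f g ⟨q, t, ht, hq, hf⟩ ⟨q', t', ht', hq', hg⟩
    refine ⟨q + q', t + t', add_nonneg ht ht', by rw [dualObjective_add, hq, hq', add_zero],
      fun p => ?_⟩
    have := add_le_add (hf p) (hg p)
    simp only [separatedSum_apply, Prod.fst_add, Prod.snd_add, BoundedContinuousFunction.coe_add,
      Pi.add_apply] at this ⊢
    linarith
  zero_mem' := ⟨0, 0, le_rfl, by simp [dualObjective], fun p => by simp [separatedSum_apply]⟩
  smul_mem' := by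
    rintro ⟨a, ha⟩ f ⟨q, t, ht, hq, hf⟩
    refine ⟨a • q, a * t, mul_nonneg ha ht, by rw [dualObjective_smul, hq, mul_zero], fun p => ?_⟩
    have := mul_le_mul_of_nonneg_left (hf p) ha
    change separatedSum (a • q) p + a * t * (V - c p) ≤ a * f p
    simp only [separatedSum_apply, Prod.smul_fst, Prod.smul_snd,
      BoundedContinuousFunction.coe_smul, smul_eq_mul] at this ⊢
    linarith

/-- For `t > 0`, dividing by `t` gives an admissible pair of value `V - a / t`, which cannot exceed
`V`. For `t = 0`, integrate the inequality `φ + ψ ≤ a`. -/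
theorem nonneg_of_const_mem_dualCone {c : X × Y → ℝ} {V : ℝ}
    (hV : ∀ q ∈ dualAdmissible c, dualObjective μ ν q ≤ V) {a : ℝ}
    (ha : a • (1 : X × Y →ᵇ ℝ) ∈ dualCone μ ν c V) : 0 ≤ a := by
  obtain ⟨q, t, ht, hq, h⟩ := ha
  have h' : ∀ x y, q.1 x + q.2 y + t * (V - c (x, y)) ≤ a := fun x y => by
    simpa [separatedSum_apply] using h (x, y)
  rcases ht.eq_or_lt with rfl | ht
  · rw [← hq]
    exact dualObjective_le_of_add_le μ ν fun x y => by simpa using h' x y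
  · have := hV (t⁻¹ • q + (BoundedContinuousFunction.const X (V - t⁻¹ * a), 0)) fun x y => by
      have := mul_le_mul_of_nonneg_left (h' x y) (inv_pos.mpr ht).le
      rw [mul_add, inv_mul_cancel_left₀ ht.ne'] at this
      simp only [Prod.fst_add, Prod.smul_fst, Prod.snd_add, Prod.smul_snd, add_zero,
        BoundedContinuousFunction.coe_add, BoundedContinuousFunction.coe_smul, Pi.add_apply,
        smul_eq_mul, BoundedContinuousFunction.const_apply]
      linarith
    rw [dualObjective_add, dualObjective_smul, hq, dualObjective_const] at this
    have : 0 ≤ t⁻¹ * a := by linarith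
    exact nonneg_of_mul_nonneg_right this (inv_pos.mpr ht)

/-- A bound for the dual problem is an upper bound for the cost of some state with the given
marginals. -/
theorem exists_state_of_dual_le [Nonempty X] [Nonempty Y] (c : X × Y →ᵇ ℝ) {V : ℝ}
    (hV : ∀ q ∈ dualAdmissible c, dualObjective μ ν q ≤ V) :
    ∃ L : (X × Y →ᵇ ℝ) →ₗ[ℝ] ℝ, IsState L ∧ (∀ q, L (separatedSum q) = dualObjective μ ν q) ∧
      L c ≤ V := by
  have hne : (1 : X × Y →ᵇ ℝ) ≠ 0 := fun h =>
    one_ne_zero (DFunLike.congr_fun h (Classical.arbitrary (X × Y)) : (1 : ℝ) = 0)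
  -- Extend `a • 1 ↦ a` from the constants; the second condition holds because `f + ‖f‖` is
  -- nonnegative and so lies in the cone.
  obtain ⟨L, hL1, hL⟩ := riesz_extension (dualCone μ ν c V)
    (LinearPMap.mkSpanSingleton (1 : X × Y →ᵇ ℝ) (1 : ℝ) hne) (by
      rintro ⟨_, hf⟩ hmem
      obtain ⟨a, rfl⟩ := Submodule.mem_span_singleton.mp hf
      erw [LinearPMap.mkSpanSingleton'_apply]
      simpa using nonneg_of_const_mem_dualCone μ ν hV hmem) (by
      intro f
      refine ⟨⟨‖f‖ • 1, Submodule.mem_span_singleton.mpr ⟨_, rfl⟩⟩, 0, 0, le_rfl,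
        by simp [dualObjective], fun p => ?_⟩
      have := (abs_le.mp (f.norm_coe_le_norm p)).1
      simp [separatedSum_apply]
      linarith)
  have hone : L 1 = 1 := by
    have := hL1 ⟨(1 : ℝ) • 1, Submodule.mem_span_singleton.mpr ⟨1, rfl⟩⟩
    erw [LinearPMap.mkSpanSingleton'_apply] at this
    simpa using this
  have hzero : ∀ q, dualObjective μ ν q = 0 → 0 ≤ L (separatedSum q) := fun q hq =>
    hL _ ⟨q, 0, le_rfl, hq, fun p => by simp⟩
  have hle : ∀ q, dualObjective μ ν q ≤ L (separatedSum q) := fun q => by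
    have := hzero (q + (BoundedContinuousFunction.const X (-dualObjective μ ν q), 0))
      (by rw [dualObjective_add, dualObjective_const, add_neg_cancel])
    have hs : separatedSum (q + (BoundedContinuousFunction.const X (-dualObjective μ ν q), 0)) =
        separatedSum q - dualObjective μ ν q • 1 := by
      ext p
      simp [separatedSum_apply]
      ring
    rw [hs, map_sub, map_smul, hone] at this
    simpa using this
  refine ⟨L, ⟨fun f hf => hL f ⟨0, 0, le_rfl, by simp [dualObjective], fun p => by
    simpa [separatedSum_apply] using hf p⟩, hone⟩, fun q => le_antisymm ?_ (hle q), ?_⟩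
  -- Both sides are linear in `q`, so the inequality for `-q` is the reverse one.
  · have := hle ((-1 : ℝ) • q)
    have hs : separatedSum ((-1 : ℝ) • q) = -separatedSum q := by
      ext p
      simp [separatedSum_apply]
      ring
    rw [hs, dualObjective_smul, map_neg] at this
    linarith
  -- The element of the cone with zero potentials and `t = 1`.
  · have := hL (V • 1 - c) ⟨0, 1, zero_le_one, by simp [dualObjective], fun p => by
      simp [separatedSum_apply]⟩
    rw [map_sub, map_smul, hone] at this
    simpa using this

end Duality

end BaireTransport

end

/-! ### The main theorem -/

open BaireTransport
theorem corollary3 {X Y : Type*} [TopologicalSpace X] [T35Space X] [TopologicalSpace Y]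
    [T35Space Y] [MeasurableSpace X] [BaireSigmaAlgebra X] [MeasurableSpace Y]
    [BaireSigmaAlgebra Y] (c : X × Y → ℝ) (hc : ∃ M : ℝ, ∀ p, |c p| ≤ M) (hH : PropertyH c)
    (μ : Measure X) [IsProbabilityMeasure μ] (hμ : IsSeparableMeasure μ)
    (ν : Measure Y) [IsProbabilityMeasure ν] (hν : IsSeparableMeasure ν) :
    ∃ γ ∈ plans μ ν, ∃ (ξ₀ : X →ᵇ ℝ) (φ : X →ᵇ ℝ) (ψ : Y →ᵇ ℝ),
      (∀ γ' ∈ plans μ ν, γ.integral c ≤ γ'.integral c) ∧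
      (φ : X → ℝ) = cBarTransform c (cTransform c ξ₀) ∧
      (ψ : Y → ℝ) = cTransform c ξ₀ ∧
      (φ, ψ) ∈ dualAdmissible c ∧
      (∀ q ∈ dualAdmissible c, dualObjective μ ν q ≤ dualObjective μ ν (φ, ψ)) ∧
      ∫ x, φ x ∂μ + ∫ y, ψ y ∂ν = valueDP c μ ν ∧
      valueDP c μ ν = valueOP c μ ν ∧
      valueOP c μ ν = γ.integral c := by
  obtain ⟨M, hM⟩ := hc
  have := nonempty_of_isProbabilityMeasure μ
  have := nonempty_of_isProbabilityMeasure ν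
  have hdX := isBoundedContinuousPseudometric_costDist hM hH.1
  have hdY := isBoundedContinuousPseudometric_costDist (c := c ∘ Prod.swap)
    (fun p => hM p.swap) hH.2
  obtain ⟨⟨ξ₀, ζ₀⟩, hadm, hmax⟩ := exists_isMaxOn_dualObjective hM hdX hdY μ hμ ν hν
  obtain ⟨ψ, hψ⟩ := exists_boundedContinuous_cTransform hM hdY ξ₀
  obtain ⟨φ, hφ⟩ := exists_boundedContinuous_cBarTransform hM hdX ψ
  have hadm' : (φ, ψ) ∈ dualAdmissible c := fun x y => by
    change φ x + ψ y ≤ c (x, y)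
    rw [hφ]
    exact cBarTransform_add_le hM ψ.norm_coe_le_norm x y
  have hmax' : ∀ q ∈ dualAdmissible c, dualObjective μ ν q ≤ dualObjective μ ν (φ, ψ) := by
    -- Transforming twice raises both potentials of the optimal pair pointwise, so the new pair is
    -- optimal too.
    refine fun q hq => (hmax q hq).trans (dualObjective_mono μ ν (fun x => ?_) fun y => ?_)
    · change ξ₀ x ≤ φ x
      rw [hφ]
      refine le_ciInf fun y => ?_
      have := cTransform_le hM ξ₀.norm_coe_le_norm x y
      rw [← hψ] at this
      linarith
    · change ζ₀ y ≤ ψ y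
      rw [hψ]
      refine le_ciInf fun x => ?_
      have : ξ₀ x + ζ₀ y ≤ c (x, y) := hadm x y
      linarith
  -- Here `V` is the attained dual value, so the cost of the resulting plan is squeezed to equal it
  -- by weak duality.
  obtain ⟨L, hL, hLq, hLc⟩ := exists_state_of_dual_le μ ν
    (BoundedContinuousFunction.ofNormedAddCommGroup c (hH.continuous hM) M hM) hmax'
  have hγ : hL.charge ∈ plans μ ν := fun φ ψ =>
    (hL.integral_charge (separatedSum (φ, ψ))).trans (hLq (φ, ψ))
  have hγc : hL.charge.integral c = dualObjective μ ν (φ, ψ) :=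
    le_antisymm ((hL.integral_charge _).trans_le hLc) (dualObjective_le_integral μ ν hM hγ hadm')
  have hmin : ∀ γ' ∈ plans μ ν, hL.charge.integral c ≤ γ'.integral c := fun γ' hγ' =>
    hγc.trans_le (dualObjective_le_integral μ ν hM hγ' hadm')
  have hDP : valueDP c μ ν = dualObjective μ ν (φ, ψ) :=
    IsGreatest.csSup_eq ⟨⟨_, hadm', rfl⟩, by rintro _ ⟨q, hq, rfl⟩; exact hmax' q hq⟩
  have hOP : valueOP c μ ν = hL.charge.integral c :=
    IsLeast.csInf_eq ⟨⟨_, hγ, rfl⟩, by rintro _ ⟨γ', hγ', rfl⟩; exact hmin γ' hγ'⟩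
  exact ⟨hL.charge, hγ, ξ₀, φ, ψ, hmin, hψ ▸ hφ, hψ, hadm', hmax', hDP.symm,
    by rw [hDP, hOP, hγc], hOP⟩
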